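/- For a set $I\subseteq[n]=\{1,\dots,n\}$ write $S(I)=\{x\in I: x\le n/2\}$ and $k(I)=\sum_{a\in S(I)}\left(\frac n2-a\right)$, and let $O_n$ be the set of odd numbers in $[n]$. A set is sum-free if it contains no solution of $x+y=z$ (where $x=y$ is allowed), and an $m$-subset is a subset of size $m$. For a function $m=m(n)$, "almost every sum-free $m$-subset of $[n]$ has property $P$" means that the proportion of sum-free $m$-subsets of $[n]$ that have $P$ tends to $1$ as $n\to\infty$. There exist constants $C>0$ and $\varepsilon_0>0$ such that the following holds for every $0<\varepsilon\le\varepsilon_0$ and every function $m=m(n)$ with $C\sqrt{n\log n}\le m$ for all sufficiently large $n$ and $m=o(n)$. (1) Almost every sum-free $m$-subset $I$ of $[n]$ satisfies $$|S(I)|\ \ge\ \frac{\varepsilon n}{m}\qquad\text{and}\qquad k(I)\ \ge\ \frac{\varepsilon n^3}{m^3}.$$ (2) Consequently, the upper bounds "almost every sum-free $m$-subset $I$ of $[n]$ satisfies either $I\subseteq O_n$, or $|S(I)|\le C'n/m+\omega(n)$ and $k(I)\le C'n^3/m^3+\omega(n)$", where $C'$ is a constant and $\omega(n)\to\infty$ arbitrarily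 slowly, are sharp up to constant factors, in the following sense: if $f:\mathbb N\to\mathbb R$ is such that almost every sum-free $m$-subset $I$ of $[n]$ satisfies $I\subseteq O_n$ or $|S(I)|\le f(n)$, then $f(n)\ge\varepsilon n/m$ for all sufficiently large $n$; and if $g:\mathbb N\to\mathbb R$ is such that almost every sum-free $m$-subset $I$ of $[n]$ satisfies $I\subseteq O_n$ or $k(I)\le g(n)$, then $g(n)\ge\varepsilon n^3/m^3$ for all sufficiently large $n$. -/

import Mathlib

open Filter Topology

namespace SumFree

/-- A set of natural numbers is sum-free if it contains no solution of `x + y = z`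
(the case `x = y` is included). -/
def IsSumFree (I : Finset ℕ) : Prop :=
  ∀ x ∈ I, ∀ y ∈ I, x + y ∉ I

open Classical in
/-- The sum-free `m`-subsets of `[n] = {1, …, n}`. -/
noncomputable def sumFreeSubsets (n m : ℕ) : Finset (Finset ℕ) :=
  ((Finset.Icc 1 n).powersetCard m).filter IsSumFree

/-- `S(I) = {x ∈ I : x ≤ n / 2}`, where `n / 2` is the rational number. -/
def lowerPart (n : ℕ) (I : Finset ℕ) : Finset ℕ :=
  I.filter fun x => 2 * x ≤ n

/-- `k(I) = ∑_{a ∈ S(I)} (n / 2 - a)`. -/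
noncomputable def lowerWeight (n : ℕ) (I : Finset ℕ) : ℝ :=
  ∑ a ∈ lowerPart n I, ((n : ℝ) / 2 - (a : ℝ))

/-- `O_n`, the set of odd numbers in `[n]`. -/
def oddNumbers (n : ℕ) : Finset ℕ :=
  (Finset.Icc 1 n).filter Odd

open Classical in
/-- For `m = m(n)`, almost every sum-free `m`-subset of `[n]` has the property `P n`: the proportion
of those that have it tends to `1` as `n → ∞`. -/
def AlmostEvery (m : ℕ → ℕ) (P : ℕ → Finset ℕ → Prop) : Prop :=
  Tendsto
    (fun n : ℕ => (((sumFreeSubsets n (m n)).filter (P n)).card : ℝ) /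
      ((sumFreeSubsets n (m n)).card : ℝ))
    atTop (𝓝 1)

end SumFree

namespace SumFree

/-! Split the sum-free `m`-sets into levels by `s = |S(I)|`. With `p` the integer part of `n / (8192
m)`, each level with `s + 1 ≤ 2p` is at most half as large as the next (`two_mul_card_level_le`). To
see this, let the window be the `w ≈ n² / (256 m²)` largest numbers of the lower half. For an
average `I` in the level, at least half of the window can be added to `I` without destroying
sum-freeness; adding such an element and deleting one from the upper part leads to the next level,
and a double count gives the factor 2.

That most window elements are available is a first-moment estimate. The level has no product
structure, but one upper element can be exchanged for at least `n / 4` others, so it behaves, up to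
a constant, like a uniform point of the upper half (`sum_exchange_le`).

Doubling has three consequences. Sets with `|S(I)| < p` have proportion at most `2^(-p)`. There are
at least `4^p` times as many sum-free `m`-sets as `m`-subsets of the upper half, hence subsets of
`O_n` are rare. Finally, sets with small `k(I)` number at most `e^p` times the `m`-subsets of the
upper half, by an exponential-moment bound that ignores sum-freeness (`card_filter_lowerWeight_le`),
so their proportion is at most `(e/4)^p`. Since `m = o(n)`, `p → ∞`. Sharpness follows because two
typical properties and the failure of a rare one hold together for some set. -/

/-- The elements of `I` above `n / 2`. -/
def upperPart (n : ℕ) (I : Finset ℕ) : Finset ℕ :=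
  I.filter fun x => n < 2 * x

/-- The sum-free `m`-subsets of `[n]` with exactly `s` elements in the lower half. -/
noncomputable def level (n m s : ℕ) : Finset (Finset ℕ) :=
  (sumFreeSubsets n m).filter fun I => (lowerPart n I).card = s

theorem mem_sumFreeSubsets {n m : ℕ} {I : Finset ℕ} :
    I ∈ sumFreeSubsets n m ↔ (I ⊆ Finset.Icc 1 n ∧ I.card = m) ∧ IsSumFree I := by
  simp [sumFreeSubsets, Finset.mem_powersetCard]

theorem mem_level {n m s : ℕ} {I : Finset ℕ} :
    I ∈ level n m s ↔
      ((I ⊆ Finset.Icc 1 n ∧ I.card = m) ∧ IsSumFree I) ∧ (lowerPart n I).card = s := by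
  simp [level, mem_sumFreeSubsets]

theorem mem_lowerPart {n x : ℕ} {I : Finset ℕ} : x ∈ lowerPart n I ↔ x ∈ I ∧ 2 * x ≤ n := by
  simp [lowerPart]

theorem mem_upperPart {n x : ℕ} {I : Finset ℕ} : x ∈ upperPart n I ↔ x ∈ I ∧ n < 2 * x := by
  simp [upperPart]

theorem card_lowerPart_add_card_upperPart (n : ℕ) (I : Finset ℕ) :
    (lowerPart n I).card + (upperPart n I).card = I.card := by
  have h := Finset.card_filter_add_card_filter_not (s := I) (fun x => 2 * x ≤ n)
  simpa [lowerPart, upperPart] using h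

theorem IsSumFree.mono {I J : Finset ℕ} (hJ : IsSumFree J) (h : I ⊆ J) : IsSumFree I :=
  fun x hx y hy hxy => hJ x (h hx) y (h hy) (h hxy)

/-- A positive element can be added to a sum-free set if it creates none of the possible
solutions of `x + y = z`. -/
theorem IsSumFree.insert {I : Finset ℕ} {a : ℕ} (hI : IsSumFree I) (h0 : ∀ x ∈ I, 0 < x)
    (ha : 0 < a) (h1 : ∀ x ∈ I, ∀ y ∈ I, x + y ≠ a) (h2 : ∀ x ∈ I, a + x ∉ I) (h3 : a + a ∉ I) :
    IsSumFree (insert a I) := by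
  intro x hx y hy hxy
  rw [Finset.mem_insert] at hx hy hxy
  rcases hx with rfl | hx
  · rcases hy with rfl | hy
    · rcases hxy with h | h
      · omega
      · exact h3 h
    · rcases hxy with h | h
      · have := h0 y hy; omega
      · exact h2 y hy h
  · rcases hy with rfl | hy
    · rcases hxy with h | h
      · have := h0 x hx; omega
      · exact h2 x hx (by rwa [add_comm])
    · rcases hxy with h | h
      · exact h1 x hx y hy h
      · exact hI x hx y hy h

/-! ### Exchanging upper elements within a level -/

/-- The elements of the upper half that can replace any element of the upper part of `I`. -/
def freeUpper (n : ℕ) (I : Finset ℕ) : Finset ℕ :=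
  Finset.Ioc (n / 2) n \ (I ∪ (Finset.image₂ (fun x z => x + z) (lowerPart n I) I ∪
    Finset.image₂ (fun x z => z - x) (lowerPart n I) I))

theorem card_freeUpper {n m s : ℕ} {I : Finset ℕ} (hI : I ∈ level n m s)
    (h : 4 * (m + 2 * (s * m)) ≤ n) : n ≤ 4 * (freeUpper n I).card := by
  obtain ⟨⟨⟨-, hm⟩, -⟩, hs⟩ := mem_level.1 hI
  have h1 := Finset.card_image₂_le (fun x z : ℕ => x + z) (lowerPart n I) I
  have h2 := Finset.card_image₂_le (fun x z : ℕ => z - x) (lowerPart n I) I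
  have h3 := Finset.card_union_le I (Finset.image₂ (fun x z => x + z) (lowerPart n I) I ∪
    Finset.image₂ (fun x z => z - x) (lowerPart n I) I)
  have h4 := Finset.card_union_le (Finset.image₂ (fun x z : ℕ => x + z) (lowerPart n I) I)
    (Finset.image₂ (fun x z => z - x) (lowerPart n I) I)
  have h5 := Finset.le_card_sdiff (I ∪ (Finset.image₂ (fun x z => x + z) (lowerPart n I) I ∪
    Finset.image₂ (fun x z => z - x) (lowerPart n I) I)) (Finset.Ioc (n / 2) n)
  rw [Nat.card_Ioc] at h5
  rw [hs, hm] at h1 h2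
  rw [hm] at h3
  unfold freeUpper
  omega

/-- Two numbers above `n / 2` sum to more than `n`, so any solution created by `y'` involves a lower
element `x`, as `x + z = y'` or `x + y' = z`; both are excluded by `freeUpper`. -/
theorem exchange_mem_level {n m s y y' : ℕ} {I : Finset ℕ} (hI : I ∈ level n m s)
    (hy : y ∈ upperPart n I) (hy' : y' ∈ freeUpper n I) :
    insert y' (I.erase y) ∈ level n m s := by
  obtain ⟨⟨⟨hsub, hm⟩, hsf⟩, hs⟩ := mem_level.1 hI
  obtain ⟨hyI, hyn⟩ := mem_upperPart.1 hy
  simp only [freeUpper, Finset.mem_sdiff, Finset.mem_union, Finset.mem_image₂, not_or,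
    Finset.mem_Ioc, not_exists, not_and] at hy'
  obtain ⟨⟨hlo, hhi⟩, hnI, hadd, hsubt⟩ := hy'
  have hpos : ∀ x ∈ I, 0 < x := fun x hx => (Finset.mem_Icc.1 (hsub hx)).1
  have hle : ∀ x ∈ I, x ≤ n := fun x hx => (Finset.mem_Icc.1 (hsub hx)).2
  have her : I.erase y ⊆ I := Finset.erase_subset _ _
  have hn' : y' ∉ I.erase y := fun h => hnI (her h)
  refine mem_level.2 ⟨⟨⟨?_, ?_⟩, ?_⟩, ?_⟩
  · refine Finset.insert_subset (Finset.mem_Icc.2 ⟨by omega, hhi⟩) (her.trans hsub)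
  · rw [Finset.card_insert_of_notMem hn', Finset.card_erase_add_one hyI, hm]
  · refine (hsf.mono her).insert (fun x hx => hpos x (her hx)) (by omega) ?_ ?_ ?_
    · intro x hx z hz hxz
      have hx := her hx
      have hz := her hz
      rcases le_or_gt (2 * x) n with h | h
      · exact hadd x (mem_lowerPart.2 ⟨hx, h⟩) z hz hxz
      · exact hadd z (mem_lowerPart.2 ⟨hz, by omega⟩) x hx (by omega)
    · intro x hx hxz
      have hx := her hx
      have hxz := her hxz
      have := hle _ hxz
      exact hsubt x (mem_lowerPart.2 ⟨hx, by omega⟩) _ hxz (by omega)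
    · intro h
      have := hle _ (her h)
      omega
  · rw [← hs]
    congr 1
    ext x
    simp only [mem_lowerPart, Finset.mem_insert, Finset.mem_erase]
    constructor
    · rintro ⟨rfl | h, hx⟩
      · omega
      · exact ⟨h.2, hx⟩
    · rintro ⟨h, hx⟩
      exact ⟨Or.inr ⟨by rintro rfl; omega, h⟩, hx⟩

/-- First moments over a level are bounded by those of a uniformly random element of the upper
half, through exchanging one upper element. -/
theorem sum_exchange_le {n m s : ℕ} (h : 4 * (m + 2 * (s * m)) ≤ n)
    (F : Finset ℕ → ℕ → ℕ) :
    n * ∑ I ∈ level n m s, ∑ y ∈ upperPart n I, F (I.erase y) y ≤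
      4 * ∑ J ∈ level n m s, ∑ y' ∈ upperPart n J, ∑ y ∈ Finset.Ioc (n / 2) n,
        F (J.erase y') y := by
  have key : ∑ I ∈ level n m s, ∑ y ∈ upperPart n I, ∑ _y' ∈ freeUpper n I, F (I.erase y) y ≤
      ∑ J ∈ level n m s, ∑ y' ∈ upperPart n J, ∑ y ∈ Finset.Ioc (n / 2) n, F (J.erase y') y := by
    rw [Finset.sum_sigma', Finset.sum_sigma', Finset.sum_sigma', Finset.sum_sigma']
    have hback : ∀ x ∈ ((level n m s).sigma fun I => upperPart n I).sigma
        (fun q => freeUpper n q.1), x.2 ∉ x.1.1 := by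
      rintro ⟨⟨I, y⟩, y'⟩ hx
      simp only [Finset.mem_sigma, freeUpper, Finset.mem_sdiff, Finset.mem_union, not_or] at hx
      exact hx.2.2.1
    have herase : ∀ x ∈ ((level n m s).sigma fun I => upperPart n I).sigma
        (fun q => freeUpper n q.1),
        (insert x.2 (x.1.1.erase x.1.2)).erase x.2 = x.1.1.erase x.1.2 := by
      intro x hx
      exact Finset.erase_insert fun h => hback x hx (Finset.mem_of_mem_erase h)
    -- The swap `(I, y, y') ↦ (J, y', y)` is reversible and keeps the common remainder `I.erase y =
    -- J.erase y'`, the only set on which `F` depends.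
    let e : ((_ : (_ : Finset ℕ) × ℕ) × ℕ) → ((_ : (_ : Finset ℕ) × ℕ) × ℕ) :=
      fun x => ⟨⟨insert x.2 (x.1.1.erase x.1.2), x.2⟩, x.1.2⟩
    have hinj : Set.InjOn e (((level n m s).sigma fun I => upperPart n I).sigma
        (fun q => freeUpper n q.1)) := by
      rintro ⟨⟨I, y⟩, y'⟩ hx ⟨⟨J, z⟩, z'⟩ hx' heq
      have h1 := herase _ hx
      have h2 := herase _ hx'
      simp only [e, Sigma.mk.injEq, heq_eq_eq] at heq
      obtain ⟨⟨ha, rfl⟩, rfl⟩ := heq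
      have h3 : I.erase y = J.erase y := by
        dsimp only at h1 h2
        rw [← h1, ← h2, ha]
      simp only [Finset.coe_sigma, Set.mem_sigma_iff, Finset.mem_coe, mem_upperPart] at hx hx'
      have : I = J := by
        rw [← Finset.insert_erase hx.1.2.1, ← Finset.insert_erase hx'.1.2.1, h3]
      subst this
      rfl
    calc _ = ∑ x ∈ ((level n m s).sigma fun I => upperPart n I).sigma
              (fun q => freeUpper n q.1), F ((e x).1.1.erase (e x).1.2) (e x).2 := by
          refine Finset.sum_congr rfl fun x hx => ?_
          simp only [e, herase x hx]
      _ = ∑ x ∈ (((level n m s).sigma fun I => upperPart n I).sigma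
              (fun q => freeUpper n q.1)).image e, F (x.1.1.erase x.1.2) x.2 :=
          (Finset.sum_image (f := fun x : ((_ : (_ : Finset ℕ) × ℕ) × ℕ) =>
            F (x.1.1.erase x.1.2) x.2) hinj).symm
      _ ≤ _ := by
          refine Finset.sum_le_sum_of_subset ?_
          intro x hx
          obtain ⟨⟨⟨I, y⟩, y'⟩, hq, rfl⟩ := Finset.mem_image.1 hx
          simp only [Finset.mem_sigma] at hq ⊢
          obtain ⟨⟨hI, hy⟩, hy'⟩ := hq
          have hy'' := (Finset.mem_Ioc.1 (Finset.mem_sdiff.1 hy').1)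
          have hyu := mem_upperPart.1 hy
          have := (Finset.mem_Icc.1 ((mem_level.1 hI).1.1.1 hyu.1)).2
          refine ⟨⟨exchange_mem_level hI hy hy', mem_upperPart.2 ⟨Finset.mem_insert_self _ _, ?_⟩⟩,
            Finset.mem_Ioc.2 ⟨?_, this⟩⟩
          · change n < 2 * y'
            omega
          · change n / 2 < y
            omega
  refine le_trans ?_ (Nat.mul_le_mul_left 4 key)
  rw [Finset.mul_sum, Finset.mul_sum]
  refine Finset.sum_le_sum fun I hI => ?_
  rw [Finset.mul_sum, Finset.mul_sum]
  refine Finset.sum_le_sum fun y _ => ?_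
  rw [Finset.sum_const, smul_eq_mul, ← mul_assoc]
  exact Nat.mul_le_mul_right _ (card_freeUpper hI h)

theorem pos_of_mem_level {n m s x : ℕ} {I : Finset ℕ} (hI : I ∈ level n m s) (hx : x ∈ I) :
    0 < x :=
  (Finset.mem_Icc.1 ((mem_level.1 hI).1.1.1 hx)).1

theorem le_of_mem_level {n m s x : ℕ} {I : Finset ℕ} (hI : I ∈ level n m s) (hx : x ∈ I) :
    x ≤ n :=
  (Finset.mem_Icc.1 ((mem_level.1 hI).1.1.1 hx)).2

theorem card_upperPart_le {n m s : ℕ} {I : Finset ℕ} (hI : I ∈ level n m s) :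
    (upperPart n I).card ≤ m :=
  (Finset.card_le_card (Finset.filter_subset _ _)).trans_eq (mem_level.1 hI).1.1.2

theorem lowerPart_erase {n y : ℕ} {I : Finset ℕ} (hy : n < 2 * y) :
    lowerPart n (I.erase y) = lowerPart n I := by
  ext x
  simp only [mem_lowerPart, Finset.mem_erase]
  constructor
  · rintro ⟨h, hx⟩
    exact ⟨h.2, hx⟩
  · rintro ⟨h, hx⟩
    exact ⟨⟨by rintro rfl; omega, h⟩, hx⟩

/-! ### Conflicts that block window elements, and their averages over a level -/

/-- The `w` largest numbers of the lower half. -/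
def window (n w : ℕ) : Finset ℕ :=
  Finset.Ioc (n / 2 - w) (n / 2)

theorem card_window {n w : ℕ} (h : 2 * w ≤ n) : (window n w).card = w := by
  rw [window, Nat.card_Ioc]; omega

theorem mem_window {n w a : ℕ} : a ∈ window n w ↔ n / 2 - w < a ∧ a ≤ n / 2 := by
  simp [window]

/-- The `a` in the window for which `z` lies in `{a} + (S(R) ∪ {a})`. -/
def lowerConflicts (n w : ℕ) (R : Finset ℕ) (z : ℕ) : Finset ℕ :=
  (window n w).filter fun a => a + a = z ∨ ∃ x ∈ lowerPart n R, a + x = z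

/-- The `a` in the window for which `y + a` lies in `R`. -/
def upperConflicts (n w : ℕ) (R : Finset ℕ) (y : ℕ) : Finset ℕ :=
  (window n w).filter fun a => y + a ∈ R

theorem sum_card_lowerConflicts_le {n w : ℕ} (h : 2 * w ≤ n) (R Z : Finset ℕ) :
    ∑ z ∈ Z, (lowerConflicts n w R z).card ≤ w * ((lowerPart n R).card + 1) := by
  have := Finset.sum_card_bipartiteAbove_eq_sum_card_bipartiteBelow (s := Z) (t := window n w)
    (fun z a => a + a = z ∨ ∃ x ∈ lowerPart n R, a + x = z)
  simp only [Finset.bipartiteAbove, Finset.bipartiteBelow] at this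
  unfold lowerConflicts
  rw [this]
  calc _ ≤ ∑ a ∈ window n w, ((lowerPart n R).card + 1) := by
        refine Finset.sum_le_sum fun a _ => ?_
        refine (Finset.card_le_card (t := insert (a + a) ((lowerPart n R).image (a + ·))) ?_).trans
          ((Finset.card_insert_le _ _).trans (Nat.succ_le_succ Finset.card_image_le))
        intro z hz
        obtain ⟨-, rfl | ⟨x, hx, rfl⟩⟩ := Finset.mem_filter.1 hz
        · simp
        · exact Finset.mem_insert_of_mem (Finset.mem_image_of_mem _ hx)
    _ = _ := by rw [Finset.sum_const, card_window h, smul_eq_mul]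

/-- For fixed `a` in the window, `y > n / 2` forces `y + a > n - w`, so only the few elements of `R`
near `n` can be hit. -/
theorem sum_card_upperConflicts_le {n w : ℕ} (h : 2 * w ≤ n) (R : Finset ℕ) :
    ∑ y ∈ Finset.Ioc (n / 2) n, (upperConflicts n w R y).card ≤
      w * (R.filter fun z => n - w < z).card := by
  have := Finset.sum_card_bipartiteAbove_eq_sum_card_bipartiteBelow (s := Finset.Ioc (n / 2) n)
    (t := window n w) (fun y a => y + a ∈ R)
  simp only [Finset.bipartiteAbove, Finset.bipartiteBelow] at this
  unfold upperConflicts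
  rw [this]
  calc _ ≤ ∑ a ∈ window n w, (R.filter fun z => n - w < z).card := by
        refine Finset.sum_le_sum fun a ha => ?_
        refine Finset.card_le_card_of_injOn (· + a) ?_ (fun x _ y _ hxy => by simpa using hxy)
        intro y hy
        simp only [Finset.mem_coe, Finset.mem_filter, Finset.mem_Ioc] at hy ⊢
        rw [mem_window] at ha
        exact ⟨hy.2, by omega⟩
    _ = _ := by rw [Finset.sum_const, card_window h, smul_eq_mul]

/-- These conflicts see only the lower part of `I`, which survives the deletion of `z`; one exchange
then makes `z` essentially uniform. -/
theorem sum_level_lowerConflicts_le {n m s w : ℕ} (h : 4 * (m + 2 * (s * m)) ≤ n)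
    (hw : 2 * w ≤ n) :
    n * ∑ I ∈ level n m s, ∑ z ∈ upperPart n I, (lowerConflicts n w I z).card ≤
      4 * ((level n m s).card * (m * (w * (s + 1)))) := by
  calc _ = n * ∑ I ∈ level n m s, ∑ z ∈ upperPart n I, (lowerConflicts n w (I.erase z) z).card := by
        congr 1
        refine Finset.sum_congr rfl fun I _ => Finset.sum_congr rfl fun z hz => ?_
        rw [lowerConflicts, lowerConflicts, lowerPart_erase (mem_upperPart.1 hz).2]
    _ ≤ _ := sum_exchange_le h fun R z => (lowerConflicts n w R z).card
    _ ≤ _ := by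
        refine Nat.mul_le_mul_left 4 ?_
        rw [← smul_eq_mul (level n m s).card, ← Finset.sum_const]
        refine Finset.sum_le_sum fun J hJ => ?_
        refine le_trans ?_ (Nat.mul_le_mul_right _ (card_upperPart_le hJ))
        rw [← smul_eq_mul (upperPart n J).card, ← Finset.sum_const]
        refine Finset.sum_le_sum fun y hy => ?_
        have := sum_card_lowerConflicts_le hw (J.erase y) (Finset.Ioc (n / 2) n)
        rwa [lowerPart_erase (mem_upperPart.1 hy).2, (mem_level.1 hJ).2] at this

theorem sum_level_top_le {n m s w : ℕ} (h : 4 * (m + 2 * (s * m)) ≤ n) (hw : 2 * w ≤ n) :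
    n * ∑ I ∈ level n m s, (I.filter fun z => n - w < z).card ≤
      4 * ((level n m s).card * (m * w)) := by
  calc _ ≤ n * ∑ I ∈ level n m s, ∑ z ∈ upperPart n I, if n - w < z then 1 else 0 := by
        refine Nat.mul_le_mul_left n (Finset.sum_le_sum fun I _ => ?_)
        rw [← Finset.card_filter]
        refine Finset.card_le_card fun z hz => ?_
        rw [Finset.mem_filter] at hz ⊢
        exact ⟨mem_upperPart.2 ⟨hz.1, by omega⟩, hz.2⟩
    _ ≤ _ := sum_exchange_le h fun _ z => if n - w < z then 1 else 0
    _ ≤ _ := by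
        refine Nat.mul_le_mul_left 4 ?_
        rw [← smul_eq_mul (level n m s).card, ← Finset.sum_const]
        refine Finset.sum_le_sum fun J hJ => ?_
        refine le_trans ?_ (Nat.mul_le_mul_right _ (card_upperPart_le hJ))
        rw [← smul_eq_mul (upperPart n J).card, ← Finset.sum_const]
        refine Finset.sum_le_sum fun y hy => ?_
        rw [← Finset.card_filter]
        refine (Finset.card_le_card (t := Finset.Ioc (n - w) n) fun z hz => ?_).trans ?_
        · rw [Finset.mem_filter, Finset.mem_Ioc] at hz
          exact Finset.mem_Ioc.2 ⟨hz.2, hz.1.2⟩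
        · rw [Nat.card_Ioc]; omega

/-- Both `y` and `y + a` are upper elements, so the exchange is applied twice: first to `y`, then to
the element above `n - w` through `sum_level_top_le`. Each use saves a factor of order `n`. -/
theorem sum_level_upperConflicts_le {n m s w : ℕ} (h : 4 * (m + 2 * (s * m)) ≤ n)
    (hw : 2 * w ≤ n) :
    n ^ 2 * ∑ I ∈ level n m s, ∑ y ∈ upperPart n I, (upperConflicts n w I y).card ≤
      16 * ((level n m s).card * (m * w) ^ 2) := by
  have h1 : n * ∑ I ∈ level n m s, ∑ y ∈ upperPart n I, (upperConflicts n w I y).card ≤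
      4 * (m * w * ∑ J ∈ level n m s, (J.filter fun z => n - w < z).card) := by
    calc _ = n * ∑ I ∈ level n m s, ∑ y ∈ upperPart n I,
            (upperConflicts n w (I.erase y) y).card := by
          congr 1
          refine Finset.sum_congr rfl fun I _ => Finset.sum_congr rfl fun y _ => ?_
          congr 1
          refine Finset.filter_congr fun a ha => ?_
          rw [mem_window] at ha
          rw [Finset.mem_erase, and_iff_right (by omega)]
      _ ≤ _ := sum_exchange_le h fun R y => (upperConflicts n w R y).card
      _ ≤ _ := by
          refine Nat.mul_le_mul_left 4 ?_
          rw [Finset.mul_sum]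
          refine Finset.sum_le_sum fun J hJ => ?_
          rw [mul_assoc]
          refine le_trans ?_ (Nat.mul_le_mul_right _ (card_upperPart_le hJ))
          rw [← smul_eq_mul (upperPart n J).card, ← Finset.sum_const]
          refine Finset.sum_le_sum fun y hy => ?_
          refine (sum_card_upperConflicts_le hw (J.erase y)).trans ?_
          exact Nat.mul_le_mul_left _ (Finset.card_le_card
            (Finset.filter_subset_filter _ (Finset.erase_subset _ _)))
  calc _ = n * (n * ∑ I ∈ level n m s, ∑ y ∈ upperPart n I, (upperConflicts n w I y).card) := by
        ring
    _ ≤ n * (4 * (m * w * ∑ J ∈ level n m s, (J.filter fun z => n - w < z).card)) :=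
        Nat.mul_le_mul_left _ h1
    _ = 4 * (m * w) * (n * ∑ J ∈ level n m s, (J.filter fun z => n - w < z).card) := by ring
    _ ≤ 4 * (m * w) * (4 * ((level n m s).card * (m * w))) :=
        Nat.mul_le_mul_left _ (sum_level_top_le h hw)
    _ = _ := by ring

/-! ### Extensions and the growth of levels -/

open Classical in
/-- The elements of the window that can be added to `I`. -/
noncomputable def extensions (n w : ℕ) (I : Finset ℕ) : Finset ℕ :=
  (window n w).filter fun a => a ∉ I ∧ IsSumFree (insert a I)

theorem mem_extensions {n w a : ℕ} {I : Finset ℕ} :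
    a ∈ extensions n w I ↔ a ∈ window n w ∧ a ∉ I ∧ IsSumFree (insert a I) := by
  classical
  rw [extensions, Finset.mem_filter]

theorem card_extensions_ge {n m s w : ℕ} {I : Finset ℕ} (hI : I ∈ level n m s)
    (hw : 4 * w + 4 ≤ n) :
    w ≤ (extensions n w I).card + (s + 2 * (s * s)) +
      ∑ z ∈ upperPart n I, (lowerConflicts n w I z).card +
      ∑ y ∈ upperPart n I, (upperConflicts n w I y).card := by
  obtain ⟨⟨-, hsf⟩, hs⟩ := mem_level.1 hI
  -- A blocked `a` lies in `S(I)`, is a sum or difference of two elements of `S(I)`, or has a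
  -- conflict with an upper element. As `a` exceeds roughly `n / 4`, the double `a + a` always lands
  -- in the upper half.
  have hcov : window n w ⊆ extensions n w I ∪ (lowerPart n I ∪
      (Finset.image₂ (fun x z => x + z) (lowerPart n I) (lowerPart n I) ∪
      Finset.image₂ (fun x z => z - x) (lowerPart n I) (lowerPart n I))) ∪
      (upperPart n I).biUnion (fun z => lowerConflicts n w I z) ∪
      (upperPart n I).biUnion (fun z => upperConflicts n w I z) := by
    intro a ha
    have ha' := mem_window.1 ha
    by_contra hcon
    simp only [Finset.mem_union, not_or, Finset.mem_image₂, Finset.mem_biUnion, lowerConflicts,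
      upperConflicts, Finset.mem_filter, ha, true_and, not_exists, not_and] at hcon
    obtain ⟨⟨⟨hext, hlow, hadd, hsub⟩, hlc⟩, huc⟩ := hcon
    have haI : a ∉ I := fun h => hlow (mem_lowerPart.2 ⟨h, by omega⟩)
    refine hext (mem_extensions.2 ⟨ha, haI, hsf.insert (fun x => pos_of_mem_level hI)
      (by omega) ?_ ?_ ?_⟩)
    · intro x hx y hy hxy
      exact hadd x (mem_lowerPart.2 ⟨hx, by omega⟩) y (mem_lowerPart.2 ⟨hy, by omega⟩) hxy
    · intro x hx hax
      rcases le_or_gt (2 * x) n with h | h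
      · have hx' := mem_lowerPart.2 ⟨hx, h⟩
        rcases le_or_gt (2 * (a + x)) n with h' | h'
        · exact hsub x hx' (a + x) (mem_lowerPart.2 ⟨hax, h'⟩) (by omega)
        · exact (hlc (a + x) (mem_upperPart.2 ⟨hax, h'⟩)).2 x hx' rfl
      · exact huc x (mem_upperPart.2 ⟨hx, h⟩) (by rwa [add_comm])
    · intro h
      exact (hlc (a + a) (mem_upperPart.2 ⟨h, by omega⟩)).1 rfl
  have h0 := Finset.card_le_card hcov
  rw [card_window (by omega)] at h0
  refine h0.trans ((Finset.card_union_le _ _).trans (add_le_add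
    ((Finset.card_union_le _ _).trans (add_le_add ((Finset.card_union_le _ _).trans
      (Nat.add_le_add_left ?_ _)) Finset.card_biUnion_le)) Finset.card_biUnion_le))
  refine (Finset.card_union_le _ _).trans (add_le_add hs.le ?_)
  refine (Finset.card_union_le _ _).trans ?_
  have h1 := Finset.card_image₂_le (fun x z : ℕ => x + z) (lowerPart n I) (lowerPart n I)
  have h2 := Finset.card_image₂_le (fun x z : ℕ => z - x) (lowerPart n I) (lowerPart n I)
  rw [hs] at h1 h2
  omega

/-- Numerical conditions under which an average member of `level n m s` has many extensions. -/
theorem sum_card_extensions_ge {n m s w : ℕ} (hn : 0 < n) (hw : 4 * w + 4 ≤ n)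
    (h1 : 4 * (m + 2 * (s * m)) ≤ n) (h2 : 8 * (s + 2 * (s * s)) ≤ w)
    (h3 : 64 * (m * (s + 1)) ≤ n) (h4 : 256 * (m ^ 2 * w) ≤ n ^ 2) :
    (level n m s).card * w ≤ 2 * ∑ I ∈ level n m s, (extensions n w I).card := by
  have hX := sum_level_lowerConflicts_le (w := w) h1 (by omega)
  have hY := sum_level_upperConflicts_le (w := w) h1 (by omega)
  have hsum := Finset.sum_le_sum fun I (hI : I ∈ level n m s) => card_extensions_ge hI hw
  rw [Finset.sum_add_distrib, Finset.sum_add_distrib, Finset.sum_add_distrib, Finset.sum_const,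
    Finset.sum_const, smul_eq_mul, smul_eq_mul] at hsum
  set A := (level n m s).card
  set X := ∑ I ∈ level n m s, ∑ z ∈ upperPart n I, (lowerConflicts n w I z).card
  set Y := ∑ I ∈ level n m s, ∑ y ∈ upperPart n I, (upperConflicts n w I y).card
  set E := ∑ I ∈ level n m s, (extensions n w I).card
  have hX' : 16 * X ≤ A * w := by
    refine Nat.le_of_mul_le_mul_left ?_ hn
    calc n * (16 * X) = 16 * (n * X) := by ring
      _ ≤ 16 * (4 * (A * (m * (w * (s + 1))))) := Nat.mul_le_mul_left _ hX
      _ = (64 * (m * (s + 1))) * (A * w) := by ring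
      _ ≤ n * (A * w) := Nat.mul_le_mul_right _ h3
  have hY' : 16 * Y ≤ A * w := by
    refine Nat.le_of_mul_le_mul_left ?_ (pow_pos hn 2)
    calc n ^ 2 * (16 * Y) = 16 * (n ^ 2 * Y) := by ring
      _ ≤ 16 * (16 * (A * (m * w) ^ 2)) := Nat.mul_le_mul_left _ hY
      _ = (256 * (m ^ 2 * w)) * (A * w) := by ring
      _ ≤ n ^ 2 * (A * w) := Nat.mul_le_mul_right _ h4
  have h2' : 8 * (A * (s + 2 * (s * s))) ≤ A * w := by
    calc _ = A * (8 * (s + 2 * (s * s))) := by ring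
      _ ≤ _ := Nat.mul_le_mul_left _ h2
  -- The surviving fraction is at least `1 - 1/8 - 1/16 - 1/16 = 3/4`, more than the half required.
  omega

/-- Adding an extension and deleting an upper element. -/
theorem level_mul_le_level_succ {n m s w : ℕ} :
    (m - s) * ∑ I ∈ level n m s, (extensions n w I).card ≤
      (level n m (s + 1)).card * ((s + 1) * n) := by
  have hL : (m - s) * ∑ I ∈ level n m s, (extensions n w I).card =
      ((level n m s).sigma fun I => extensions n w I ×ˢ upperPart n I).card := by
    rw [Finset.card_sigma, Finset.mul_sum]
    refine Finset.sum_congr rfl fun I hI => ?_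
    have := card_lowerPart_add_card_upperPart n I
    rw [(mem_level.1 hI).2, (mem_level.1 hI).1.1.2] at this
    rw [Finset.card_product, mul_comm]
    congr 1
    omega
  have hR : ((level n m (s + 1)).sigma fun J => lowerPart n J ×ˢ Finset.Icc 1 n).card =
      (level n m (s + 1)).card * ((s + 1) * n) := by
    rw [Finset.card_sigma, ← smul_eq_mul, ← Finset.sum_const]
    refine Finset.sum_congr rfl fun J hJ => ?_
    rw [Finset.card_product, (mem_level.1 hJ).2, Nat.card_Icc, Nat.add_sub_cancel]
  rw [hL, ← hR]
  -- Recording `a` and `y` in the image allows `I` to be recovered.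
  refine Finset.card_le_card_of_injOn
    (fun x => ⟨insert x.2.1 (x.1.erase x.2.2), x.2⟩) ?_ ?_
  · rintro ⟨I, a, y⟩ hx
    simp only [Finset.coe_sigma, Set.mem_sigma_iff, Finset.mem_coe, Finset.mem_product] at hx ⊢
    obtain ⟨hI, ha, hy⟩ := hx
    obtain ⟨haw, haI, hasf⟩ := mem_extensions.1 ha
    rw [mem_window] at haw
    obtain ⟨hyI, hyn⟩ := mem_upperPart.1 hy
    obtain ⟨⟨⟨hsub, hm⟩, hsf⟩, hs⟩ := mem_level.1 hI
    have hyle := le_of_mem_level hI hyI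
    have her : I.erase y ⊆ I := Finset.erase_subset _ _
    have haE : a ∉ I.erase y := fun h => haI (her h)
    refine ⟨mem_level.2 ⟨⟨⟨Finset.insert_subset (Finset.mem_Icc.2 ⟨by omega, by omega⟩)
      (her.trans hsub), ?_⟩, hasf.mono (Finset.insert_subset_insert _ her)⟩, ?_⟩,
      mem_lowerPart.2 ⟨Finset.mem_insert_self _ _, by omega⟩, Finset.mem_Icc.2 ⟨by omega, hyle⟩⟩
    · rw [Finset.card_insert_of_notMem haE, Finset.card_erase_add_one hyI, hm]
    · rw [lowerPart, Finset.filter_insert, if_pos (by omega), Finset.card_insert_of_notMem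
        (fun h => haE (Finset.mem_filter.1 h).1)]
      change (lowerPart n (I.erase y)).card + 1 = s + 1
      rw [lowerPart_erase hyn, hs]
  · rintro ⟨I, a, y⟩ hx ⟨J, b, z⟩ hx' heq
    simp only [Finset.coe_sigma, Set.mem_sigma_iff, Finset.mem_coe, Finset.mem_product] at hx hx'
    simp only [Sigma.mk.injEq, heq_eq_eq, Prod.mk.injEq] at heq
    obtain ⟨h, rfl, rfl⟩ := heq
    have ha := (mem_extensions.1 hx.2.1).2.1
    have hb := (mem_extensions.1 hx'.2.1).2.1
    have h3 : I.erase y = J.erase y := by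
      rw [← Finset.erase_insert (s := I.erase y) (a := a) fun h => ha (Finset.mem_of_mem_erase h),
        h, Finset.erase_insert fun h => hb (Finset.mem_of_mem_erase h)]
    have : I = J := by
      rw [← Finset.insert_erase (mem_upperPart.1 hx.2.2).1,
        ← Finset.insert_erase (mem_upperPart.1 hx'.2.2).1, h3]
    subst this
    rfl

/-- The double count gives a growth factor of about `w m / (4 (s + 1) n)`, which is at least 2
because `s + 1 ≤ 2p` and `16 p n ≤ w m`. -/
theorem two_mul_card_level_le {n m s p : ℕ} (hm : 0 < m) (hp : 0 < p)
    (hpn : 8192 * (m * p) ≤ n) (hnm : n ≤ m ^ 2) (hs : s + 1 ≤ 2 * p) :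
    2 * (level n m s).card ≤ (level n m (s + 1)).card := by
  have hmp : 0 < m * p := Nat.mul_pos hm hp
  have hn : 0 < n := by omega
  have hm2 : 0 < 256 * m ^ 2 := by positivity
  -- The widest window for which upper conflicts stay below the `1/16` threshold.
  obtain ⟨w, hw⟩ : ∃ w, w = n ^ 2 / (256 * m ^ 2) := ⟨_, rfl⟩
  have hw1 : 256 * (m ^ 2 * w) ≤ n ^ 2 := by
    rw [← mul_assoc, hw]; exact Nat.mul_div_le _ _
  have hw2 : n ^ 2 < 256 * m ^ 2 * (w + 1) := by
    rw [hw]; exact Nat.lt_mul_div_succ _ hm2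
  have hw3 : 64 * p ^ 2 ≤ w := by
    rw [hw, Nat.le_div_iff_mul_le hm2]
    calc 64 * p ^ 2 * (256 * m ^ 2) = (128 * (m * p)) ^ 2 := by ring
      _ ≤ n ^ 2 := Nat.pow_le_pow_left (by omega) 2
  have hwn : 256 * w ≤ n := by
    refine Nat.le_of_mul_le_mul_left ?_ hn
    calc n * (256 * w) ≤ m ^ 2 * (256 * w) := Nat.mul_le_mul_right _ hnm
      _ = 256 * (m ^ 2 * w) := by ring
      _ ≤ n * n := by rwa [← sq]
  have hsm : (s + 1) * m ≤ 2 * (m * p) :=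
    (Nat.mul_le_mul_right m hs).trans_eq (by ring)
  have hs2 : s + 2 * (s * s) ≤ 8 * p ^ 2 :=
    calc s + 2 * (s * s) ≤ 2 * ((s + 1) * (s + 1)) := by nlinarith
      _ ≤ 2 * ((2 * p) * (2 * p)) := Nat.mul_le_mul_left _ (Nat.mul_le_mul hs hs)
      _ = _ := by ring
  have hE := sum_card_extensions_ge (n := n) (m := m) (s := s) (w := w) hn (by omega)
    (by nlinarith) (by omega) (by nlinarith) hw1
  have hU := level_mul_le_level_succ (n := n) (m := m) (s := s) (w := w)
  have hpm : 8192 * p ≤ m := by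
    refine Nat.le_of_mul_le_mul_left ?_ hm
    calc m * (8192 * p) = 8192 * (m * p) := by ring
      _ ≤ n := hpn
      _ ≤ m * m := by rwa [← sq]
  -- The constant `8192 = 512 * 16` is used in full here; one factor 2 in `512` pays for rounding
  -- `w` down.
  have hwm : 16 * (p * n) ≤ w * m := by
    have hw0 : 1 ≤ w := le_trans (by have := Nat.pow_pos (n := 2) hp; omega) hw3
    refine Nat.le_of_mul_le_mul_left ?_ (show 0 < 512 * m by omega)
    calc 512 * m * (16 * (p * n)) = (8192 * (m * p)) * n := by ring
      _ ≤ n * n := Nat.mul_le_mul_right _ hpn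
      _ ≤ 256 * m ^ 2 * (w + 1) := by rw [← sq]; exact hw2.le
      _ ≤ 256 * m ^ 2 * (2 * w) := Nat.mul_le_mul_left _ (by omega)
      _ = 512 * m * (w * m) := by ring
  set A := (level n m s).card
  set B := (level n m (s + 1)).card
  set E := ∑ I ∈ level n m s, (extensions n w I).card
  refine Nat.le_of_mul_le_mul_left ?_ (show 0 < 8 * (p * n) by positivity)
  calc 8 * (p * n) * (2 * A) = A * (16 * (p * n)) := by ring
    _ ≤ A * (w * m) := Nat.mul_le_mul_left _ hwm
    _ ≤ A * (w * (2 * (m - s))) := Nat.mul_le_mul_left _ (Nat.mul_le_mul_left _ (by omega))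
    _ = 2 * (m - s) * (A * w) := by ring
    _ ≤ 2 * (m - s) * (2 * E) := Nat.mul_le_mul_left _ hE
    _ = 4 * ((m - s) * E) := by ring
    _ ≤ 4 * (B * ((s + 1) * n)) := Nat.mul_le_mul_left _ hU
    _ ≤ 4 * (B * (2 * p * n)) :=
      Nat.mul_le_mul_left _ (Nat.mul_le_mul_left _ (Nat.mul_le_mul_right _ hs))
    _ = 8 * (p * n) * B := by ring

theorem two_pow_mul_card_level_le {n m p : ℕ} (hm : 0 < m) (hp : 0 < p)
    (hpn : 8192 * (m * p) ≤ n) (hnm : n ≤ m ^ 2) (s j : ℕ) (hs : s + j ≤ 2 * p) :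
    2 ^ j * (level n m s).card ≤ (level n m (s + j)).card := by
  induction j with
  | zero => simp
  | succ j ih =>
    calc 2 ^ (j + 1) * (level n m s).card = 2 * (2 ^ j * (level n m s).card) := by ring
      _ ≤ 2 * (level n m (s + j)).card := Nat.mul_le_mul_left _ (ih (by omega))
      _ ≤ _ := two_mul_card_level_le hm hp hpn hnm (by omega)

/-! ### Consequences of doubling: small lower parts and odd sets are rare -/

theorem card_level_le (n m s : ℕ) : (level n m s).card ≤ (sumFreeSubsets n m).card :=
  Finset.card_le_card (Finset.filter_subset _ _)

theorem choose_le_card_level_zero (n m : ℕ) :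
    (n - n / 2).choose m ≤ (level n m 0).card := by
  rw [← Nat.card_Ioc, ← Finset.card_powersetCard]
  refine Finset.card_le_card fun I hI => ?_
  obtain ⟨hsub, hm⟩ := Finset.mem_powersetCard.1 hI
  have h : ∀ x ∈ I, n / 2 < x ∧ x ≤ n := fun x hx => Finset.mem_Ioc.1 (hsub hx)
  refine mem_level.2 ⟨⟨⟨fun x hx => ?_, hm⟩, fun x hx y hy hxy => ?_⟩, ?_⟩
  · have := h x hx
    exact Finset.mem_Icc.2 (by omega)
  · have := h x hx
    have := h y hy
    have := h _ hxy
    omega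
  · rw [Finset.card_eq_zero, Finset.eq_empty_iff_forall_notMem]
    intro x hx
    obtain ⟨hx, hx2⟩ := mem_lowerPart.1 hx
    have := h x hx
    omega

/-- The number of sum-free sets is exponentially larger than the number of subsets of the upper
half. -/
theorem four_pow_mul_choose_le {n m p : ℕ} (hm : 0 < m) (hp : 0 < p)
    (hpn : 8192 * (m * p) ≤ n) (hnm : n ≤ m ^ 2) :
    4 ^ p * (n - n / 2).choose m ≤ (sumFreeSubsets n m).card :=
  calc 4 ^ p * (n - n / 2).choose m = 2 ^ (2 * p) * (n - n / 2).choose m := by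
        rw [pow_mul]; norm_num
    _ ≤ 2 ^ (2 * p) * (level n m 0).card :=
        Nat.mul_le_mul_left _ (choose_le_card_level_zero n m)
    _ ≤ (level n m (0 + 2 * p)).card :=
        two_pow_mul_card_level_le hm hp hpn hnm 0 (2 * p) (by omega)
    _ ≤ _ := card_level_le _ _ _

/-- Few sum-free sets have a small lower part. -/
theorem two_pow_mul_card_filter_lowerPart_lt {n m p : ℕ} (hm : 0 < m) (hp : 0 < p)
    (hpn : 8192 * (m * p) ≤ n) (hnm : n ≤ m ^ 2) :
    2 ^ p * ((sumFreeSubsets n m).filter fun I => (lowerPart n I).card < p).card ≤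
      (sumFreeSubsets n m).card := by
  have h1 : ((sumFreeSubsets n m).filter fun I => (lowerPart n I).card < p).card =
      ∑ s ∈ Finset.range p, (level n m s).card := by
    rw [Finset.card_eq_sum_card_fiberwise (f := fun I => (lowerPart n I).card)
      (t := Finset.range p)]
    · refine Finset.sum_congr rfl fun s hs => ?_
      rw [Finset.filter_filter, level]
      congr 1
      refine Finset.filter_congr fun I _ => ?_
      have := Finset.mem_range.1 hs
      constructor
      · exact fun h => h.2
      · exact fun h => ⟨by omega, h⟩
    · intro I hI
      simpa using (Finset.mem_filter.1 hI).2
  -- Each level below `p` is compared with the one `p` steps higher; these targets are disjoint.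
  have h2 : ∑ s ∈ Finset.range p, (level n m (s + p)).card ≤ (sumFreeSubsets n m).card := by
    unfold level
    rw [← Finset.card_biUnion]
    · exact Finset.card_le_card (Finset.biUnion_subset.2 fun s _ => Finset.filter_subset _ _)
    · intro s _ t _ hst
      refine Finset.disjoint_filter.2 fun I _ h h' => hst (by omega)
  rw [h1, Finset.mul_sum]
  refine (Finset.sum_le_sum fun s hs => ?_).trans h2
  have := Finset.mem_range.1 hs
  exact two_pow_mul_card_level_le hm hp hpn hnm s p (by omega)

/-- Sets of odd numbers are exponentially rare among sum-free sets. -/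
theorem four_pow_mul_card_filter_odd_le {n m p : ℕ} (hm : 0 < m) (hp : 0 < p)
    (hpn : 8192 * (m * p) ≤ n) (hnm : n ≤ m ^ 2) :
    4 ^ p * ((sumFreeSubsets n m).filter fun I => I ⊆ oddNumbers n).card ≤
      (sumFreeSubsets n m).card := by
  refine le_trans (Nat.mul_le_mul_left _ ?_) (four_pow_mul_choose_le hm hp hpn hnm)
  -- There are no more odd numbers in `[n]` than numbers above `n / 2`, so the same binomial
  -- coefficient bounds both families.
  have hodd : (oddNumbers n).card ≤ n - n / 2 := by
    rw [← Nat.card_Ioc]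
    refine Finset.card_le_card_of_injOn (fun x => n / 2 + 1 + x / 2) ?_ ?_
    · intro x hx
      obtain ⟨hx, k, rfl⟩ := Finset.mem_filter.1 hx
      have := Finset.mem_Icc.1 hx
      refine Finset.mem_coe.2 (Finset.mem_Ioc.2 ?_)
      dsimp only
      omega
    · intro x hx y hy hxy
      obtain ⟨-, k, rfl⟩ := Finset.mem_filter.1 hx
      obtain ⟨-, l, rfl⟩ := Finset.mem_filter.1 hy
      dsimp only at hxy
      omega
  refine le_trans (Finset.card_le_card (t := (oddNumbers n).powersetCard m) fun I hI => ?_) ?_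
  · obtain ⟨hI, hIo⟩ := Finset.mem_filter.1 hI
    exact Finset.mem_powersetCard.2 ⟨hIo, (mem_sumFreeSubsets.1 hI).1.2⟩
  · rw [Finset.card_powersetCard]
    exact Nat.choose_le_choose m hodd

/-! ### Exponential-moment bound for the weight -/

/-- The ratio of consecutive binomials is `(k + 1) / (N - k)`, at most `m / (N - m) ≤ t`; each lower
element thus costs a factor `t`. -/
theorem choose_sub_le_mul_pow {N m : ℕ} {t : ℝ} (hN : m < N)
    (ht : (m : ℝ) ≤ t * ((N : ℝ) - m)) (s : ℕ) (hs : s ≤ m) :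
    (N.choose (m - s) : ℝ) ≤ N.choose m * t ^ s := by
  have hpos : (0 : ℝ) < (N : ℝ) - m := sub_pos.2 (by exact_mod_cast hN)
  have ht0 : 0 ≤ t := nonneg_of_mul_nonneg_left ((Nat.cast_nonneg m).trans ht) hpos
  induction s with
  | zero => simp
  | succ s ih =>
    obtain ⟨k, hk⟩ : ∃ k, m - s = k + 1 := ⟨m - s - 1, by omega⟩
    have hk' : m - (s + 1) = k := by omega
    have ih := ih (by omega)
    rw [hk] at ih
    rw [hk']
    have hrec : (N.choose (k + 1) : ℝ) * (k + 1) = N.choose k * ((N : ℝ) - k) := by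
      have := Nat.choose_succ_right_eq N k
      rw [← Nat.cast_sub (by omega)]
      exact_mod_cast this
    have hkm : (k : ℝ) + 1 ≤ m := by exact_mod_cast (by omega : k + 1 ≤ m)
    have hstep : (N.choose k : ℝ) ≤ N.choose (k + 1) * t := by
      refine le_of_mul_le_mul_right ?_ hpos
      calc (N.choose k : ℝ) * ((N : ℝ) - m) ≤ N.choose k * ((N : ℝ) - k) :=
            mul_le_mul_of_nonneg_left (by linarith) (Nat.cast_nonneg _)
        _ = N.choose (k + 1) * (k + 1) := hrec.symm
        _ ≤ N.choose (k + 1) * (t * ((N : ℝ) - m)) := by gcongr; exact hkm.trans ht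
        _ = _ := by ring
    calc (N.choose k : ℝ) ≤ N.choose (k + 1) * t := hstep
      _ ≤ (N.choose m * t ^ s) * t := by gcongr
      _ = _ := by ring

/-- A geometric series of ratio `e^(-θ)`, with `1 - e^(-θ) ≥ θ / 2` on `(0, 1]`. -/
theorem sum_exp_neg_le {n : ℕ} {θ : ℝ} (h0 : 0 < θ) (h1 : θ ≤ 1) :
    ∑ a ∈ Finset.Icc 1 (n / 2), Real.exp (-(θ * ((n : ℝ) / 2 - a))) ≤ 2 / θ := by
  set r := Real.exp (-θ)
  have hr0 : 0 < r := Real.exp_pos _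
  have hr : θ / 2 ≤ 1 - r := by
    have h2 : r ≤ 1 / (1 + θ) := by
      rw [le_div_iff₀ (by linarith)]
      calc r * (1 + θ) ≤ r * Real.exp θ := by
            gcongr; linarith [Real.add_one_le_exp θ]
        _ = 1 := by rw [← Real.exp_add]; simp
    have h3 : 1 / (1 + θ) ≤ 1 - θ / 2 := by
      rw [div_le_iff₀ (by linarith)]; nlinarith
    linarith
  have hreindex : ∑ a ∈ Finset.Icc 1 (n / 2), r ^ (n / 2 - a) =
      ∑ j ∈ Finset.range (n / 2), r ^ j := by
    refine Finset.sum_nbij' (fun a => n / 2 - a) (fun j => n / 2 - j) ?_ ?_ ?_ ?_ ?_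
    all_goals
      intro a ha
      simp only [Finset.mem_Icc, Finset.mem_range] at ha ⊢
      try omega
  calc _ ≤ ∑ a ∈ Finset.Icc 1 (n / 2), r ^ (n / 2 - a) := by
        refine Finset.sum_le_sum fun a ha => ?_
        have ha' := (Finset.mem_Icc.1 ha).2
        rw [← Real.exp_nat_mul, Nat.cast_sub ha']
        refine Real.exp_le_exp.2 ?_
        have : ((n / 2 : ℕ) : ℝ) ≤ (n : ℝ) / 2 := Nat.cast_div_le
        nlinarith
    _ = ∑ j ∈ Finset.range (n / 2), r ^ j := hreindex
    _ ≤ 2 / θ := by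
        have hg := geom_sum_mul_neg r (n / 2)
        have hS : 0 ≤ ∑ j ∈ Finset.range (n / 2), r ^ j := by positivity
        have hrp : 0 ≤ r ^ (n / 2) := by positivity
        rw [le_div_iff₀ h0]
        nlinarith

open Classical in
/-- Exponential-moment bound for the number of sets whose lower part has small weight. -/
theorem card_filter_lowerWeight_le {n m : ℕ} {κ θ t : ℝ} (hN : m < n - n / 2)
    (ht : (m : ℝ) ≤ t * (((n - n / 2 : ℕ) : ℝ) - m)) (h0 : 0 < θ) (h1 : θ ≤ 1) :
    (((sumFreeSubsets n m).filter fun I => lowerWeight n I ≤ κ).card : ℝ) ≤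
      (n - n / 2).choose m * Real.exp (θ * κ + t * (2 / θ)) := by
  have hpos : (0 : ℝ) < ((n - n / 2 : ℕ) : ℝ) - m := sub_pos.2 (by exact_mod_cast hN)
  have ht0 : 0 ≤ t := nonneg_of_mul_nonneg_left ((Nat.cast_nonneg m).trans ht) hpos
  set k : Finset ℕ → ℝ := fun S => ∑ a ∈ S, ((n : ℝ) / 2 - a)
  set P := (Finset.Icc 1 (n / 2)).powerset.filter fun S => S.card ≤ m ∧ k S ≤ κ
  have hcard : ((sumFreeSubsets n m).filter fun I => lowerWeight n I ≤ κ).card ≤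
      (P.sigma fun S => (Finset.Ioc (n / 2) n).powersetCard (m - S.card)).card := by
    refine Finset.card_le_card_of_injOn (fun I => ⟨lowerPart n I, upperPart n I⟩) ?_ ?_
    · intro I hI
      obtain ⟨hI, hw⟩ := Finset.mem_filter.1 hI
      obtain ⟨⟨hsub, hm⟩, -⟩ := mem_sumFreeSubsets.1 hI
      have hc := card_lowerPart_add_card_upperPart n I
      refine Finset.mem_coe.2 (Finset.mem_sigma.2 ⟨Finset.mem_filter.2
        ⟨Finset.mem_powerset.2 fun x hx => ?_, by dsimp only; omega, hw⟩,
        Finset.mem_powersetCard.2 ⟨fun x hx => ?_, by dsimp only; omega⟩⟩)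
      · obtain ⟨hx, hx2⟩ := mem_lowerPart.1 hx
        have := Finset.mem_Icc.1 (hsub hx)
        exact Finset.mem_Icc.2 (by omega)
      · obtain ⟨hx, hx2⟩ := mem_upperPart.1 hx
        have := Finset.mem_Icc.1 (hsub hx)
        exact Finset.mem_Ioc.2 (by omega)
    · intro I _ J _ h
      simp only [Sigma.mk.injEq, heq_eq_eq] at h
      have hdec : ∀ I : Finset ℕ, I = lowerPart n I ∪ upperPart n I := by
        intro I
        ext x
        simp only [Finset.mem_union, mem_lowerPart, mem_upperPart]
        constructor
        · intro hx
          rcases le_or_gt (2 * x) n with h | h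
          · exact Or.inl ⟨hx, h⟩
          · exact Or.inr ⟨hx, h⟩
        · rintro (h | h) <;> exact h.1
      rw [hdec I, hdec J, h.1, h.2]
  rw [Finset.card_sigma] at hcard
  calc (((sumFreeSubsets n m).filter fun I => lowerWeight n I ≤ κ).card : ℝ)
      ≤ ∑ S ∈ P, ((n - n / 2).choose (m - S.card) : ℝ) := by
        refine (Nat.cast_le.2 hcard).trans_eq ?_
        rw [Nat.cast_sum]
        refine Finset.sum_congr rfl fun S _ => ?_
        rw [Finset.card_powersetCard, Nat.card_Ioc]
    _ ≤ ∑ S ∈ P, (n - n / 2).choose m * Real.exp (θ * κ) *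
          ∏ a ∈ S, t * Real.exp (-(θ * ((n : ℝ) / 2 - a))) := by
        refine Finset.sum_le_sum fun S hS => ?_
        obtain ⟨-, hSm, hSk⟩ := Finset.mem_filter.1 hS
        refine (choose_sub_le_mul_pow hN ht _ hSm).trans ?_
        rw [Finset.prod_mul_distrib, Finset.prod_const, ← Real.exp_sum, Finset.sum_neg_distrib,
          ← Finset.mul_sum]
        -- Chernoff's trick: inserting this factor lets the constraint `k S ≤ κ` be dropped, after
        -- which the sum over all `S` factorises.
        have h2 : (1 : ℝ) ≤ Real.exp (θ * κ) * Real.exp (-(θ * k S)) := by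
          rw [← Real.exp_add]
          exact Real.one_le_exp (by nlinarith)
        calc ((n - n / 2).choose m : ℝ) * t ^ S.card
            ≤ ((n - n / 2).choose m * t ^ S.card) *
                (Real.exp (θ * κ) * Real.exp (-(θ * k S))) :=
              le_mul_of_one_le_right (by positivity) h2
          _ = _ := by ring
    _ ≤ ∑ S ∈ (Finset.Icc 1 (n / 2)).powerset, (n - n / 2).choose m * Real.exp (θ * κ) *
          ∏ a ∈ S, t * Real.exp (-(θ * ((n : ℝ) / 2 - a))) :=
        Finset.sum_le_sum_of_subset_of_nonneg (Finset.filter_subset _ _)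
          fun _ _ _ => by positivity
    _ = (n - n / 2).choose m * Real.exp (θ * κ) *
          ∏ a ∈ Finset.Icc 1 (n / 2), (1 + t * Real.exp (-(θ * ((n : ℝ) / 2 - a)))) := by
        rw [← Finset.mul_sum, Finset.prod_one_add]
    _ ≤ (n - n / 2).choose m * Real.exp (θ * κ) *
          ∏ a ∈ Finset.Icc 1 (n / 2), Real.exp (t * Real.exp (-(θ * ((n : ℝ) / 2 - a)))) := by
        gcongr with a
        rw [add_comm]
        exact Real.add_one_le_exp _
    _ = (n - n / 2).choose m * Real.exp (θ * κ +
          t * ∑ a ∈ Finset.Icc 1 (n / 2), Real.exp (-(θ * ((n : ℝ) / 2 - a)))) := by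
        rw [← Real.exp_sum, ← Finset.mul_sum, Real.exp_add, mul_assoc]
    _ ≤ _ := by
        gcongr
        exact sum_exp_neg_le h0 h1

open Classical in
/-- Few sum-free sets have a lower part of small weight. -/
theorem four_pow_mul_card_filter_lowerWeight_le {n m p : ℕ} (hm : 0 < m) (hp : 0 < p)
    (hpn : 8192 * (m * p) ≤ n) (hnp : n ≤ 16384 * (m * p)) (hnm : n ≤ m ^ 2)
    (hmn : 512 * m ≤ n) {ε : ℝ} (hε : ε ≤ 1 / (128 * 8192 ^ 2)) :
    4 ^ p * (((sumFreeSubsets n m).filter fun I =>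
        lowerWeight n I ≤ ε * (n : ℝ) ^ 3 / (m : ℝ) ^ 3).card : ℝ) ≤
      Real.exp p * (sumFreeSubsets n m).card := by
  have hmR : (0 : ℝ) < m := by exact_mod_cast hm
  have hnR : (0 : ℝ) < n := by exact_mod_cast (by omega : 0 < n)
  have hmnR : 512 * (m : ℝ) ≤ n := by exact_mod_cast hmn
  have hhalf : (n : ℝ) / 2 ≤ ((n - n / 2 : ℕ) : ℝ) := by
    rw [Nat.cast_sub (Nat.div_le_self _ _)]
    have : ((n / 2 : ℕ) : ℝ) ≤ (n : ℝ) / 2 := Nat.cast_div_le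
    linarith
  have hq : (n : ℝ) / m ≤ 16384 * p := by
    rw [div_le_iff₀ hmR]
    have : (n : ℝ) ≤ 16384 * (m * p) := by exact_mod_cast hnp
    linarith
  -- Since `262144 = 512²`, `θ ≤ 1` is exactly `512 m ≤ n`. With `ε ≤ 2^(-33)`, both `θκ` and `2t/θ`
  -- are at most `n / (32768 m)`, so together at most `n / (16384 m) ≤ p`.
  have h1 := card_filter_lowerWeight_le (n := n) (m := m) (κ := ε * (n : ℝ) ^ 3 / (m : ℝ) ^ 3)
    (θ := 262144 * (m : ℝ) ^ 2 / (n : ℝ) ^ 2) (t := 4 * (m : ℝ) / n) (by omega)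
    (by
      rw [div_mul_eq_mul_div, le_div_iff₀ hnR]
      nlinarith)
    (by positivity)
    (by
      rw [div_le_one (by positivity)]
      nlinarith)
  have h2 : 262144 * (m : ℝ) ^ 2 / (n : ℝ) ^ 2 * (ε * (n : ℝ) ^ 3 / (m : ℝ) ^ 3) +
      4 * (m : ℝ) / n * (2 / (262144 * (m : ℝ) ^ 2 / (n : ℝ) ^ 2)) ≤ p := by
    have e1 : 262144 * (m : ℝ) ^ 2 / (n : ℝ) ^ 2 * (ε * (n : ℝ) ^ 3 / (m : ℝ) ^ 3) =
        262144 * ε * ((n : ℝ) / m) := by field_simp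
    have e2 : 4 * (m : ℝ) / n * (2 / (262144 * (m : ℝ) ^ 2 / (n : ℝ) ^ 2)) =
        1 / 32768 * ((n : ℝ) / m) := by field_simp; norm_num
    have e3 : 262144 * ε ≤ 1 / 32768 := by norm_num at hε ⊢; linarith
    have e4 : 262144 * ε * ((n : ℝ) / m) ≤ 1 / 32768 * ((n : ℝ) / m) := by gcongr
    rw [e1, e2]
    linarith
  have h3 : (4 : ℝ) ^ p * (n - n / 2).choose m ≤ (sumFreeSubsets n m).card := by
    exact_mod_cast four_pow_mul_choose_le hm hp hpn hnm
  calc _ ≤ 4 ^ p * ((n - n / 2).choose m * Real.exp p) := by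
        gcongr
        exact h1.trans (by gcongr)
    _ = Real.exp p * (4 ^ p * (n - n / 2).choose m) := by ring
    _ ≤ _ := by gcongr

/-! ### From counting to almost every set, and the choice of parameters -/

theorem AlmostEvery.of_eventually_le {m : ℕ → ℕ} {P : ℕ → Finset ℕ → Prop} {δ : ℕ → ℝ}
    (hδ : Tendsto δ atTop (𝓝 0)) (hpos : ∀ᶠ n in atTop, 0 < (sumFreeSubsets n (m n)).card)
    (h : ∀ᶠ n in atTop, ∃ B : Finset (Finset ℕ),
      (∀ I ∈ sumFreeSubsets n (m n), ¬ P n I → I ∈ B) ∧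
      (B.card : ℝ) ≤ δ n * (sumFreeSubsets n (m n)).card) :
    AlmostEvery m P := by
  classical
  unfold AlmostEvery
  have hδ' : Tendsto (fun n => 1 - δ n) atTop (𝓝 1) := by
    simpa using tendsto_const_nhds.sub hδ
  refine tendsto_of_tendsto_of_tendsto_of_le_of_le' hδ' tendsto_const_nhds ?_ ?_
  · filter_upwards [hpos, h] with n hn ⟨B, hB, hBc⟩
    have hnR : (0 : ℝ) < (sumFreeSubsets n (m n)).card := by exact_mod_cast hn
    have h1 : (sumFreeSubsets n (m n)).card ≤
        ((sumFreeSubsets n (m n)).filter (P n)).card + B.card := by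
      refine (Finset.card_le_card fun I hI => ?_).trans (Finset.card_union_le _ _)
      by_cases hP : P n I
      · exact Finset.mem_union_left _ (Finset.mem_filter.2 ⟨hI, hP⟩)
      · exact Finset.mem_union_right _ (hB I hI hP)
    have h2 : ((sumFreeSubsets n (m n)).card : ℝ) ≤
        ((sumFreeSubsets n (m n)).filter (P n)).card + B.card := by exact_mod_cast h1
    rw [le_div_iff₀ hnR]
    convert (show (1 - δ n) * ((sumFreeSubsets n (m n)).card : ℝ) ≤
      ((sumFreeSubsets n (m n)).filter (P n)).card by linarith)
  · refine Eventually.of_forall fun n => div_le_one_of_le₀ ?_ (Nat.cast_nonneg _)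
    exact Nat.cast_le.2 (Finset.card_le_card (Finset.filter_subset _ _))

/-- Two typical properties, one of them with a rare exception, occur together. -/
theorem AlmostEvery.eventually_exists {m : ℕ → ℕ} {P Q E : ℕ → Finset ℕ → Prop}
    (hP : AlmostEvery m P) (hQ : AlmostEvery m fun n I => E n I ∨ Q n I)
    (hE : ∀ᶠ n in atTop, ∃ B : Finset (Finset ℕ),
      (∀ I ∈ sumFreeSubsets n (m n), E n I → I ∈ B) ∧
      4 * B.card ≤ (sumFreeSubsets n (m n)).card) :
    ∀ᶠ n in atTop, ∃ I, P n I ∧ Q n I := by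
  classical
  -- Two proportions above `3/4` overlap in more than `1/2`, which exceeds the `1/4` allowed to the
  -- exception.
  have h34 : (3 / 4 : ℝ) < 1 := by norm_num
  filter_upwards [hP.eventually_const_lt h34, hQ.eventually_const_lt h34, hE]
    with n h1 h2 ⟨B, hB, hBc⟩
  by_contra! hno
  have hpos : (0 : ℝ) < (sumFreeSubsets n (m n)).card := by
    rcases (Nat.cast_nonneg (α := ℝ) (sumFreeSubsets n (m n)).card).eq_or_lt with h | h
    · rw [← h] at h1; norm_num at h1
    · exact h
  rw [lt_div_iff₀ hpos] at h1 h2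
  set T := sumFreeSubsets n (m n)
  have h3 : (T.filter (P n)).card + (T.filter fun I => E n I ∨ Q n I).card ≤
      T.card + B.card := by
    rw [← Finset.card_union_add_card_inter]
    refine add_le_add (Finset.card_le_card (Finset.union_subset (Finset.filter_subset _ _)
      (Finset.filter_subset _ _))) (Finset.card_le_card fun I hI => ?_)
    obtain ⟨hI1, hI2⟩ := Finset.mem_inter.1 hI
    obtain ⟨hIT, hIP⟩ := Finset.mem_filter.1 hI1
    exact hB I hIT ((Finset.mem_filter.1 hI2).2.resolve_right (hno I hIP))
  have h3' : ((T.filter (P n)).card : ℝ) + ((T.filter fun I => E n I ∨ Q n I).card : ℝ) ≤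
      T.card + B.card := by exact_mod_cast h3
  have h4 : (4 : ℝ) * B.card ≤ T.card := by exact_mod_cast hBc
  have h1' : 3 / 4 * (T.card : ℝ) < (T.filter (P n)).card := by convert h1
  have h2' : 3 / 4 * (T.card : ℝ) < (T.filter fun I => E n I ∨ Q n I).card :=
    h2.trans_eq (by congr!)
  linarith

/-- In the range `√(n log n) ≤ m = o(n)`, the integer part `p` of `n / (8192 m)` tends to infinity
and satisfies all the numerical conditions needed above. -/
theorem eventually_parameters {m : ℕ → ℕ}
    (h1 : ∀ᶠ n : ℕ in atTop, 1 * Real.sqrt ((n : ℝ) * Real.log (n : ℝ)) ≤ (m n : ℝ))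
    (h2 : (fun n : ℕ => (m n : ℝ)) =o[atTop] (fun n : ℕ => (n : ℝ))) :
    ∃ p : ℕ → ℕ, Tendsto p atTop atTop ∧ ∀ᶠ n in atTop, 0 < m n ∧ 0 < p n ∧
      8192 * (m n * p n) ≤ n ∧ n ≤ 16384 * (m n * p n) ∧ n ≤ m n ^ 2 ∧ 512 * m n ≤ n := by
  have hsq : ∀ᶠ n in atTop, n ≤ m n ^ 2 := by
    filter_upwards [h1, eventually_ge_atTop 3] with n hn hn3
    have hn3R : (3 : ℝ) ≤ n := by exact_mod_cast hn3
    have hlog : 1 ≤ Real.log n := by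
      rw [Real.le_log_iff_exp_le (by linarith)]
      exact Real.exp_one_lt_three.le.trans hn3R
    rw [one_mul] at hn
    have h := (Real.sqrt_le_left (Nat.cast_nonneg _)).1 hn
    have : (n : ℝ) ≤ (m n : ℝ) ^ 2 := by nlinarith
    exact_mod_cast this
  have hpos : ∀ᶠ n in atTop, 0 < m n := by
    filter_upwards [hsq, eventually_ge_atTop 1] with n hn hn1
    by_contra h
    have : m n = 0 := by omega
    rw [this] at hn
    simp at hn
    omega
  have hlarge : ∀ b : ℕ, ∀ᶠ n in atTop, b ≤ n / (8192 * m n) := by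
    intro b
    filter_upwards [hpos, h2.def (show (0 : ℝ) < 1 / (8192 * (b + 1)) by positivity)] with n hn hb
    rw [Real.norm_natCast, Real.norm_natCast, div_mul_eq_mul_div, one_mul,
      le_div_iff₀ (by positivity)] at hb
    rw [Nat.le_div_iff_mul_le (by omega)]
    have : m n * (8192 * (b + 1)) ≤ n := by exact_mod_cast hb
    nlinarith
  -- Once `p ≥ 1`, rounding down loses at most a factor 2, whence `16384` in the reverse inequality.
  refine ⟨fun n => n / (8192 * m n), tendsto_atTop.2 hlarge, ?_⟩
  filter_upwards [hsq, hpos, hlarge 1] with n hn hm hp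
  have h3 := Nat.mul_div_le n (8192 * m n)
  have h4 := Nat.lt_mul_div_succ n (show 0 < 8192 * m n by omega)
  rw [mul_assoc] at h3
  have h5 : m n * 1 ≤ m n * (n / (8192 * m n)) := Nat.mul_le_mul_left _ hp
  refine ⟨hm, hp, h3, ?_, hn, by omega⟩
  rw [mul_assoc, mul_add] at h4
  omega

end SumFree

/-! ### The main theorem -/

theorem mainTheorem8 :
    ∃ C : ℝ, 0 < C ∧ ∃ ε₀ : ℝ, 0 < ε₀ ∧ ∀ ε : ℝ, 0 < ε → ε ≤ ε₀ →
      ∀ m : ℕ → ℕ,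
        (∀ᶠ n : ℕ in atTop, C * Real.sqrt ((n : ℝ) * Real.log (n : ℝ)) ≤ (m n : ℝ)) →
        (fun n : ℕ => (m n : ℝ)) =o[atTop] (fun n : ℕ => (n : ℝ)) →
        -- almost every sum-free `m`-subset satisfies both lower bounds
        SumFree.AlmostEvery m (fun n I =>
          ε * (n : ℝ) / (m n : ℝ) ≤ ((SumFree.lowerPart n I).card : ℝ) ∧
          ε * (n : ℝ) ^ 3 / (m n : ℝ) ^ 3 ≤ SumFree.lowerWeight n I) ∧
        -- hence neither typical upper bound, even with the exception `I ⊆ O_n`, can be improved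
        -- by more than a constant factor
        (∀ f : ℕ → ℝ,
          SumFree.AlmostEvery m (fun n I =>
            I ⊆ SumFree.oddNumbers n ∨ ((SumFree.lowerPart n I).card : ℝ) ≤ f n) →
          ∀ᶠ n : ℕ in atTop, ε * (n : ℝ) / (m n : ℝ) ≤ f n) ∧
        (∀ g : ℕ → ℝ,
          SumFree.AlmostEvery m (fun n I =>
            I ⊆ SumFree.oddNumbers n ∨ SumFree.lowerWeight n I ≤ g n) →
          ∀ᶠ n : ℕ in atTop, ε * (n : ℝ) ^ 3 / (m n : ℝ) ^ 3 ≤ g n) := by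
  refine ⟨1, one_pos, 1 / (128 * 8192 ^ 2), by norm_num, fun ε _ hε m h1 h2 => ?_⟩
  obtain ⟨p, hp, hpar⟩ := SumFree.eventually_parameters h1 h2
  have hpos : ∀ᶠ n in atTop, 0 < (SumFree.sumFreeSubsets n (m n)).card := by
    filter_upwards [hpar] with n ⟨hm, hp0, hpn, hnp, hnm, hmn⟩
    exact (Nat.mul_pos (by positivity) (Nat.choose_pos (by omega))).trans_le
      (SumFree.four_pow_mul_choose_le hm hp0 hpn hnm)
  -- The two terms bound the proportions with small `|S(I)|` and small `k(I)`; the second decays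
  -- because `e < 4`.
  have hδ : Tendsto (fun n => (1 / 2 : ℝ) ^ p n + (Real.exp 1 / 4) ^ p n) atTop (𝓝 0) := by
    have he : Real.exp 1 / 4 < 1 := by linarith [Real.exp_one_lt_three]
    simpa using ((tendsto_pow_atTop_nhds_zero_of_lt_one (by norm_num)
      (by norm_num : (1 / 2 : ℝ) < 1)).comp hp).add
      ((tendsto_pow_atTop_nhds_zero_of_lt_one (by positivity) he).comp hp)
  have hlow : SumFree.AlmostEvery m (fun n I =>
      ε * (n : ℝ) / (m n : ℝ) ≤ ((SumFree.lowerPart n I).card : ℝ) ∧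
      ε * (n : ℝ) ^ 3 / (m n : ℝ) ^ 3 ≤ SumFree.lowerWeight n I) := by
    classical
    refine .of_eventually_le hδ hpos ?_
    filter_upwards [hpar] with n ⟨hm, hp0, hpn, hnp, hnm, hmn⟩
    refine ⟨((SumFree.sumFreeSubsets n (m n)).filter fun I =>
        (SumFree.lowerPart n I).card < p n) ∪ (SumFree.sumFreeSubsets n (m n)).filter fun I =>
        SumFree.lowerWeight n I ≤ ε * (n : ℝ) ^ 3 / (m n : ℝ) ^ 3, ?_, ?_⟩
    · intro I hI hbad
      rw [not_and_or, not_le, not_le] at hbad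
      rcases hbad with h | h
      · refine Finset.mem_union_left _ (Finset.mem_filter.2 ⟨hI, ?_⟩)
        have hmR : (0 : ℝ) < m n := by exact_mod_cast hm
        have hnpR : (n : ℝ) ≤ 16384 * (m n * p n) := by exact_mod_cast hnp
        rw [lt_div_iff₀ hmR] at h
        have hlt : ((SumFree.lowerPart n I).card : ℝ) * m n < p n * m n := by
          have : ε * n ≤ 1 / (128 * 8192 ^ 2) * n := by gcongr
          have : (0 : ℝ) < m n * p n := by positivity
          norm_num at *
          linarith
        exact_mod_cast lt_of_mul_lt_mul_right hlt hmR.le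
      · exact Finset.mem_union_right _ (Finset.mem_filter.2 ⟨hI, h.le⟩)
    · have hA := SumFree.two_pow_mul_card_filter_lowerPart_lt hm hp0 hpn hnm
      have hB := SumFree.four_pow_mul_card_filter_lowerWeight_le hm hp0 hpn hnp hnm hmn hε
      have hA' : (2 : ℝ) ^ p n * ((SumFree.sumFreeSubsets n (m n)).filter fun I =>
          (SumFree.lowerPart n I).card < p n).card ≤ (SumFree.sumFreeSubsets n (m n)).card := by
        exact_mod_cast hA
      have hU := Finset.card_union_le ((SumFree.sumFreeSubsets n (m n)).filter fun I =>
        (SumFree.lowerPart n I).card < p n) ((SumFree.sumFreeSubsets n (m n)).filter fun I =>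
        SumFree.lowerWeight n I ≤ ε * (n : ℝ) ^ 3 / (m n : ℝ) ^ 3)
      refine (Nat.cast_le.2 hU).trans ?_
      rw [Nat.cast_add, add_mul, div_pow, div_pow, one_pow, ← Real.exp_nat_mul, mul_one,
        div_mul_eq_mul_div, div_mul_eq_mul_div, one_mul]
      refine add_le_add ?_ ?_
      · rw [le_div_iff₀ (by positivity), mul_comm]
        exact hA'
      · rw [le_div_iff₀ (by positivity), mul_comm]
        convert hB
  have hodd : ∀ᶠ n in atTop, ∃ B : Finset (Finset ℕ),
      (∀ I ∈ SumFree.sumFreeSubsets n (m n), I ⊆ SumFree.oddNumbers n → I ∈ B) ∧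
      4 * B.card ≤ (SumFree.sumFreeSubsets n (m n)).card := by
    filter_upwards [hpar] with n ⟨hm, hp0, hpn, hnp, hnm, hmn⟩
    refine ⟨_, fun I hI hIo => Finset.mem_filter.2 ⟨hI, hIo⟩, le_trans
      (Nat.mul_le_mul_right _ ?_) (SumFree.four_pow_mul_card_filter_odd_le hm hp0 hpn hnm)⟩
    exact Nat.le_self_pow hp0.ne' 4
  refine ⟨hlow, fun f hf => ?_, fun g hg => ?_⟩
  · filter_upwards [hlow.eventually_exists hf hodd] with n ⟨I, hI, hIf⟩
    exact hI.1.trans hIf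
  · filter_upwards [hlow.eventually_exists hg hodd] with n ⟨I, hI, hIg⟩
    exact hI.2.trans hIg
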